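/- Let $K/k$ be a separable field extension of degree $6$ with Galois closure $\widetilde K$, and suppose that $G=\mathrm{Gal}(\widetilde K/k)$ is isomorphic to $S_3\times S_3$ (that is, $G$ is the transitive group $F_{18}:2$ of degree $6$). Let $F$ be a field with $K\subseteq F\subseteq\widetilde K$ and put $G''=\mathrm{Gal}(\widetilde K/F)$. 1. If $[F:k]=18$, then $F/k$ is almost classically Galois. 2. If $[F:k]=12$, then $F/k$ is Hopf Galois but not almost classically Galois. Moreover, the action of $G$ on $G/G''$ is realized inside the holomorph of the dihedral group $D_{2\cdot 6}$ of order $12$: there is an injective homomorphism $\beta\colon G\to\mathrm{Sym}(D_{2\cdot 6})$ with $\beta(G)\subseteq\mathrm{Hol}(D_{2\cdot 6})$ such that, for $g\in G$, $\beta(g)$ fixes the identity element of $D_{2\cdot 6}$ if and only if $g\in G''$. Here $F/k$ is called *Hopf Galois* if there are a finite-dimensional cocommutative $k$-Hopf algebra $H$ and an $H$-module algebra structure on $F$ such that the $k$-linear map $j\colon F\otimes_k H\to\mathrm{End}_k(F)$, $j(s\otimes h)(t)=s\,(ht)$, is bijective. Note that $\widetilde K$ is also the Galois closure of $F/k$.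 The extension $F/k$ is called *almost classically Galois* if there is a regular (i.e. simply transitive) subgroup $N$ of $\mathrm{Sym}(G/G'')$ that is normalized by $\lambda(G)$ and contained in $\lambda(G)$, where $\lambda\colon G\to\mathrm{Sym}(G/G'')$ is the action by left multiplication on left cosets. The holomorph $\mathrm{Hol}(N)$ of a group $N$ is the normalizer in $\mathrm{Sym}(N)$ of the group of left translations. -/

import Mathlib

open scoped TensorProduct

section HopfGalois

variable {k H F : Type*} [Field k] [Ring H] [HopfAlgebra k H] [Field F] [Algebra k F]

/-- `F` is an `H`-module algebra for the action `h • s = μ h s`: one has `h • 1 = ε(h) 1` and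
`h • (s t) = ∑ (h₍₁₎ • s) (h₍₂₎ • t)`, where `Δ(h) = ∑ h₍₁₎ ⊗ h₍₂₎`. -/
structure IsModuleAlgebra (μ : H →ₐ[k] Module.End k F) : Prop where
  map_one (h : H) : μ h 1 = algebraMap k F (Coalgebra.counit (R := k) h)
  map_mul (h : H) (s t : F) :
    μ h (s * t) = LinearMap.mul' k F
      (TensorProduct.map (μ.toLinearMap.flip s) (μ.toLinearMap.flip t)
        (Coalgebra.comul (R := k) h))

/-- The `k`-linear map `j : F ⊗ H → End_k(F)` with `j (s ⊗ h) (t) = s * (h • t)`. -/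
noncomputable def hopfGaloisMap (μ : H →ₐ[k] Module.End k F) : F ⊗[k] H →ₗ[k] Module.End k F :=
  TensorProduct.lift
    ((LinearMap.mul k (Module.End k F)).compl₁₂ (Algebra.lmul k F).toLinearMap μ.toLinearMap)

theorem hopfGaloisMap_tmul (μ : H →ₐ[k] Module.End k F) (s : F) (h : H) (t : F) :
    hopfGaloisMap μ (s ⊗ₜ[k] h) t = s * μ h t := by
  simp [hopfGaloisMap]

end HopfGalois

/-- The (finite) extension `F/k` is Hopf Galois: there is a finite-dimensional cocommutative
`k`-Hopf algebra `H` for which `F` is an `H`-module algebra and `j : F ⊗ H → End_k(F)` is bijective.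
(As `k` embeds in `F`, every finite-dimensional `k`-space has a copy in the universe of `F`.) -/
def IsHopfGalois.{u, v} (k : Type u) (F : Type v) [Field k] [Field F] [Algebra k F] : Prop :=
  ∃ (H : Type v) (_ : Ring H) (_ : HopfAlgebra k H) (_ : Coalgebra.IsCocomm k H)
    (_ : Module.Finite k H) (μ : H →ₐ[k] Module.End k F),
    IsModuleAlgebra μ ∧ Function.Bijective (hopfGaloisMap μ)

/-- A group `N` of permutations of `X` is regular: it acts simply transitively on `X`. -/
def IsRegularSubgroup {X : Type*} (N : Subgroup (Equiv.Perm X)) : Prop :=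
  ∀ x y : X, ∃! σ : Equiv.Perm X, σ ∈ N ∧ σ x = y

/-- The action of a group `G` on the left cosets of `G'`, `g ↦ (x G' ↦ g x G')`. -/
def cosetPermHom {G : Type*} [Group G] (G' : Subgroup G) : G →* Equiv.Perm (G ⧸ G') :=
  MulAction.toPermHom G (G ⧸ G')

/-- The holomorph of `N`: the normalizer in `Sym(N)` of the group of left translations. -/
def holomorph (N : Type*) [Group N] : Subgroup (Equiv.Perm N) :=
  Subgroup.normalizer ((MulAction.toPermHom N N).range : Set (Equiv.Perm N))

/-- Let `L` be the Galois closure of the separable extension `F/k`, `G = Gal(L/k)` and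
`G' = Gal(L/F)`. Then `F/k` is almost classically Galois if some regular subgroup of `Sym(G/G')`
is normalized by the image of `G` and contained in it. -/
def IsAlmostClassicallyGalois {k L : Type*} [Field k] [Field L] [Algebra k L]
    (F : IntermediateField k L) (_ : IsNormalClosure k F L) : Prop :=
  ∃ N : Subgroup (Equiv.Perm ((L ≃ₐ[k] L) ⧸ F.fixingSubgroup)),
    IsRegularSubgroup N ∧
    (cosetPermHom F.fixingSubgroup).range ≤ Subgroup.normalizer (N : Set _) ∧
    N ≤ (cosetPermHom F.fixingSubgroup).range

/-- A Galois closure of `K/k` is also one of `F/k` for every field `F` between `K` and it. -/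
theorem isNormalClosure_of_le {k L : Type*} [Field k] [Field L] [Algebra k L]
    {K F : IntermediateField k L} (hK : IsNormalClosure k K L) (hKF : K ≤ F) :
    IsNormalClosure k F L := by
  have hn : Normal k L := hK.normal
  refine ⟨fun x => ?_, ?_⟩
  · rw [← minpoly.algebraMap_eq (algebraMap F L).injective x]
    exact hn.splits _
  · rw [eq_top_iff, ← hK.adjoin_rootSet]
    refine iSup_le fun x => ?_
    refine le_trans (le_of_eq ?_) (le_iSup _ (⟨x, hKF x.2⟩ : F))
    rw [← minpoly.algebraMap_eq (algebraMap F L).injective,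
      ← minpoly.algebraMap_eq (algebraMap K L).injective x]
    rfl

/-! Write `P` for the Galois group of `L/F`. Since `G` has order 36, the degrees 18 and 12 mean that
`P` has order 2 or 3.

Order 2: some component of the generator of `P` in `S₃ × S₃` is a transposition. The sign of that
component is a character whose kernel is a normal complement of `P`, hence acts regularly on `G/P`
(`exists_sign_of_card_two`, `exists_regular_of_sign`).

Order 3: `P` is not normal, for otherwise `F` would be its own normal closure. So both components of
its generator are 3-cycles, and up to an isomorphism `P` is the diagonal `A₃`
(`exists_equiv_diagonal`). This is the stabilizer of 1 for `(a, b) • (s, ε) = (a s b⁻¹, sign(a) ε)`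
on `S₃ × C₂ ≅ D_{2·6}`, and the action lies in the holomorph. If a regular `N` in the image of `G`
were normalized by it, its preimage `M` would be normal with `G = M P`. Then `M` contains all cubes,
which generate `G`, and regularity forces `P` to be normal (`normal_of_regular_of_cubes`).

Action in the holomorph implies Hopf Galois by Greither–Pareigis descent
(`isHopfGalois_of_holomorphAction`). The Hopf algebra is `H = L[N]^G`, with `G` acting on both `L`
and `N`. The field `F` is embedded in the functions `N → L` by listing conjugates, and `H` acts
there by translation. Descent gives `dim H = |N|`, and Dedekind independence makes `j` injective. -/

/-! ### Galois descent for functions on a finite set. -/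

section Descent

variable {k L : Type*} [Field k] [Field L] [Algebra k L]

/-- The `k`-space of functions `Y → L` that are equivariant for an action of `Gal(L/k)` on `Y`. -/
def equivariantFunctions {Y : Type*} (ρ : (L ≃ₐ[k] L) →* Equiv.Perm Y) :
    Submodule k (Y → L) where
  carrier := {f | ∀ g y, f (ρ g y) = g (f y)}
  add_mem' := fun {a b} ha hb g y => by simp [ha g y, hb g y]
  zero_mem' := fun g y => by simp
  smul_mem' := fun c f hf g y => by simp [hf g y]

/-- Scale an `L`-relation by `l` and sum its Galois conjugates: equivariance gives a `k`-relation
with coefficients `Tr(l aᵢ)`. These vanish for every `l`, so nondegeneracy of the trace form gives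
`aᵢ = 0`. -/
theorem linearIndependent_of_equivariant [FiniteDimensional k L] [IsGalois k L]
    {Y ι : Type*} [Finite ι] (ρ : (L ≃ₐ[k] L) →* Equiv.Perm Y) {v : ι → Y → L}
    (hv : ∀ i, v i ∈ equivariantFunctions ρ) (hi : LinearIndependent k v) :
    LinearIndependent L v := by
  have := Fintype.ofFinite ι
  rw [Fintype.linearIndependent_iff] at hi ⊢
  intro a ha
  have key : ∀ (l : L) (i : ι), Algebra.trace k L (l * a i) = 0 := by
    intro l
    refine hi _ ?_
    funext y
    have h1 : ∀ g : L ≃ₐ[k] L, ∑ i, g (l * a i) * v i y = 0 := by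
      intro g
      have h2 := congr_fun ha ((ρ g).symm y)
      simp only [Finset.sum_apply, Pi.smul_apply, smul_eq_mul, Pi.zero_apply] at h2
      have h3 : ∀ i, v i y = g (v i ((ρ g).symm y)) := fun i => by
        rw [← hv i g, Equiv.apply_symm_apply]
      calc ∑ i, g (l * a i) * v i y = g (l * ∑ i, a i * v i ((ρ g).symm y)) := by
            rw [Finset.mul_sum, map_sum]
            exact Finset.sum_congr rfl fun i _ => by rw [h3]; simp [mul_assoc]
        _ = 0 := by rw [h2]; simp
    simp only [Finset.sum_apply, Pi.smul_apply, Pi.zero_apply]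
    simp only [Algebra.smul_def, trace_eq_sum_automorphisms, Finset.sum_mul]
    rw [Finset.sum_comm]
    exact Finset.sum_eq_zero fun g _ => h1 g
  intro i
  refine (traceForm_nondegenerate k L).1 (a i) fun l => ?_
  rw [Algebra.traceForm_apply, mul_comm]
  exact key l i

theorem span_equivariantFunctions [FiniteDimensional k L] {Y : Type*} [Finite Y]
    (ρ : (L ≃ₐ[k] L) →* Equiv.Perm Y) :
    Submodule.span L (equivariantFunctions ρ : Set (Y → L)) = ⊤ := by
  classical
  have := Fintype.ofFinite Y
  by_contra hne
  obtain ⟨φ, hφ0, hφ⟩ := Submodule.exists_le_ker_of_lt_top _ (lt_top_iff_ne_top.2 hne)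
  refine hφ0 (LinearMap.pi_ext' fun y => LinearMap.ext_ring ?_)
  have hdual := linearIndependent_monoidHom L L
  have hdual' : LinearIndependent L (fun g : L ≃ₐ[k] L => ((g : L →* L) : L → L)) :=
    hdual.comp (fun g : L ≃ₐ[k] L => (g : L →* L)) fun g h hgh => by
      ext x; exact DFunLike.congr_fun hgh x
  rw [Fintype.linearIndependent_iff] at hdual'
  have hz := hdual' (fun g => φ (Pi.single (ρ g y) 1)) ?_ 1
  · simpa using hz
  funext l
  -- The orbit sum of `l` placed at `y` is equivariant. A functional `φ` killing all of these gives
  -- a relation between the automorphisms of `L`, and Dedekind's coefficient at `g = 1` is `φ` at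
  -- the point `y`.
  have hmem : (∑ g : L ≃ₐ[k] L, Pi.single (ρ g y) (g l) : Y → L) ∈ equivariantFunctions ρ := by
    intro h z
    simp only [Finset.sum_apply, map_sum]
    rw [← Equiv.sum_comp (Equiv.mulLeft h)]
    refine Finset.sum_congr rfl fun g _ => ?_
    rw [Equiv.coe_mulLeft, show ρ (h * g) y = ρ h (ρ g y) by simp, AlgEquiv.mul_apply]
    by_cases hzy : z = ρ g y
    · subst hzy; simp
    · rw [Pi.single_eq_of_ne hzy, Pi.single_eq_of_ne (fun h' => hzy ((ρ h).injective h')), map_zero]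
  have h0 := hφ (Submodule.subset_span hmem)
  rw [LinearMap.mem_ker, map_sum] at h0
  simp only [Finset.sum_apply, Pi.smul_apply, smul_eq_mul, Pi.zero_apply]
  rw [← h0]
  refine Finset.sum_congr rfl fun g _ => ?_
  have : (Pi.single (ρ g y) (g l) : Y → L) = g l • Pi.single (ρ g y) 1 := by
    rw [← Pi.single_smul, smul_eq_mul, mul_one]
  rw [this, map_smul, smul_eq_mul, mul_comm]
  rfl

theorem finrank_equivariantFunctions [FiniteDimensional k L] [IsGalois k L] {Y : Type*} [Finite Y]
    (ρ : (L ≃ₐ[k] L) →* Equiv.Perm Y) :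
    Module.finrank k (equivariantFunctions ρ) = Nat.card Y := by
  have := Fintype.ofFinite Y
  have : FiniteDimensional k (Y → L) := inferInstance
  let b := Module.finBasis k (equivariantFunctions ρ)
  have hk : LinearIndependent k (fun i => (b i : Y → L)) :=
    b.linearIndependent.map' (equivariantFunctions ρ).subtype (Submodule.ker_subtype _)
  have hl := linearIndependent_of_equivariant ρ (fun i => (b i).2) hk
  have hs : ⊤ ≤ Submodule.span L (Set.range fun i => (b i : Y → L)) := by
    rw [← span_equivariantFunctions ρ, Submodule.span_le]
    intro f hf
    have h2 := congr_arg (equivariantFunctions ρ).subtype (b.sum_repr ⟨f, hf⟩)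
    simp only [map_sum, map_smul, Submodule.subtype_apply] at h2
    rw [← h2]
    refine Submodule.sum_mem _ fun i _ => ?_
    rw [← algebraMap_smul L]
    exact Submodule.smul_mem _ _ (Submodule.subset_span ⟨i, rfl⟩)
  have h3 := Module.finrank_eq_card_basis (Module.Basis.mk hl hs)
  rw [Module.finrank_fintype_fun_eq_card, Fintype.card_fin] at h3
  rw [Nat.card_eq_fintype_card, h3]

theorem injective_of_linearIndependent_basis {V M ι : Type*} [AddCommMonoid V] [Module k V]
    [AddCommGroup M] [Module k M] [Module L M] [IsScalarTower k L M] {φ : V →ₗ[k] M}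
    (b : Module.Basis ι k V) (h : LinearIndependent L (φ ∘ b)) : Function.Injective φ := by
  have hk : LinearIndependent k (φ ∘ b) :=
    LinearIndependent.restrict_scalars (by
      intro x y hxy
      exact (algebraMap k L).injective (by simpa [Algebra.smul_def] using hxy)) h
  intro x y hxy
  refine b.repr.injective (hk ?_)
  rw [← Finsupp.apply_linearCombination, ← Finsupp.apply_linearCombination,
    b.linearCombination_repr, b.linearCombination_repr, hxy]

end Descent

/-- Fix `x` and use independence of the `ψ`-family, then let `x` vary and use the `φ`-family. The
tensor product is over `k`, while independence is over `L`. -/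
theorem linearIndependent_tensorProduct_basis {k L V W X Y ι κ : Type*} [Field k] [Field L]
    [AddCommMonoid V] [Module k V]
    [AddCommMonoid W] [Module k W] [Finite ι] [Finite κ] {φ : V → X → L} {ψ : W → Y → L}
    {Φ : V ⊗[k] W → X × Y → L}
    (hΦ : ∀ v w x y, Φ (v ⊗ₜ w) (x, y) = φ v x * ψ w y)
    (b : Module.Basis ι k V) (c : Module.Basis κ k W)
    (hb : LinearIndependent L (φ ∘ b)) (hc : LinearIndependent L (ψ ∘ c)) :
    LinearIndependent L (Φ ∘ b.tensorProduct c) := by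
  have := Fintype.ofFinite ι
  have := Fintype.ofFinite κ
  rw [Fintype.linearIndependent_iff] at hb hc ⊢
  rintro a ha ⟨i, j⟩
  refine hb (fun i => a (i, j)) ?_ i
  funext x
  have h := hc (fun j => ∑ i, a (i, j) * φ (b i) x) ?_ j
  · simpa using h
  funext y
  have h := congr_fun ha (x, y)
  simp only [Finset.sum_apply, Pi.smul_apply, smul_eq_mul, Pi.zero_apply, Function.comp_apply,
    Fintype.sum_prod_type, Module.Basis.tensorProduct_apply, hΦ] at h ⊢
  rw [Finset.sum_comm] at h
  simpa [Finset.sum_mul, mul_assoc] using h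

/-- The coefficients of an element of a monoid algebra, as a `k`-linear map. -/
noncomputable def coeffFun (k L A : Type*) [Field k] [Field L] [Algebra k L] :
    MonoidAlgebra L A →ₗ[k] (A → L) where
  toFun x := x.coeff
  map_add' _ _ := rfl
  map_smul' _ _ := rfl

theorem coeffFun_injective (k L A : Type*) [Field k] [Field L] [Algebra k L] :
    Function.Injective (coeffFun k L A) :=
  fun _ _ h => MonoidAlgebra.ext (DFunLike.coe_injective h)

/-! ### Tensor products of group algebras. -/

section PairHom

variable {k L A B : Type*} [Field k] [Field L] [Algebra k L] [Group A] [Group B]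

theorem coeff_mapDomain_inl_mul_mapDomain_inr (x : MonoidAlgebra L A) (y : MonoidAlgebra L B)
    (a : A) (b : B) :
    (x.mapDomain (MonoidHom.inl A B) * y.mapDomain (MonoidHom.inr A B)).coeff (a, b) =
      x.coeff a * y.coeff b := by
  classical
  induction x using MonoidAlgebra.induction_linear with
  | zero => simp
  | add x x' hx hx' => 
    rw [MonoidAlgebra.mapDomain_add, add_mul, MonoidAlgebra.coeff_add, Finsupp.add_apply, hx, hx',
      MonoidAlgebra.coeff_add, Finsupp.add_apply, add_mul]
  | single m r =>
    induction y using MonoidAlgebra.induction_linear with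
    | zero => simp
    | add y y' hy hy' => 
      rw [MonoidAlgebra.mapDomain_add, mul_add, MonoidAlgebra.coeff_add, Finsupp.add_apply, hy, hy',
        MonoidAlgebra.coeff_add, Finsupp.add_apply, mul_add]
    | single n s =>
      simp only [MonoidAlgebra.mapDomain_single, MonoidAlgebra.single_mul_single,
        MonoidAlgebra.coeff_single, Finsupp.single_apply, MonoidHom.inl_apply, MonoidHom.inr_apply,
        Prod.mk_mul_mk, mul_one, one_mul, Prod.mk.injEq]
      split_ifs <;> simp_all

theorem commute_mapDomain_inl_inr (x : MonoidAlgebra L A) (y : MonoidAlgebra L B) :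
    Commute (x.mapDomain (MonoidHom.inl A B)) (y.mapDomain (MonoidHom.inr A B)) := by
  induction x using MonoidAlgebra.induction_linear with
  | zero => simp
  | add x x' hx hx' => rw [MonoidAlgebra.mapDomain_add]; exact hx.add_left hx'
  | single m r =>
    induction y using MonoidAlgebra.induction_linear with
    | zero => simp
    | add y y' hy hy' => rw [MonoidAlgebra.mapDomain_add]; exact hy.add_right hy'
    | single n s => simp [Commute, SemiconjBy, MonoidAlgebra.single_mul_single, mul_comm]

/-- The algebra map `L[A] ⊗ L[B] → L[A × B]` over a subfield `k` of `L`. -/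
noncomputable def pairHom (k L A B : Type*) [Field k] [Field L] [Algebra k L] [Group A] [Group B] :
    MonoidAlgebra L A ⊗[k] MonoidAlgebra L B →ₐ[k] MonoidAlgebra L (A × B) :=
  Algebra.TensorProduct.lift (MonoidAlgebra.mapDomainAlgHom k L (MonoidHom.inl A B))
    (MonoidAlgebra.mapDomainAlgHom k L (MonoidHom.inr A B)) commute_mapDomain_inl_inr

theorem pairHom_tmul (x : MonoidAlgebra L A) (y : MonoidAlgebra L B) :
    pairHom k L A B (x ⊗ₜ y) =
      x.mapDomain (MonoidHom.inl A B) * y.mapDomain (MonoidHom.inr A B) :=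
  Algebra.TensorProduct.lift_tmul _ _ _ _ _

end PairHom

/-! ### The descended group algebra `L[N]^G` and its tensor powers. -/

section GroupForm

variable {k L N : Type*} [Field k] [Field L] [Algebra k L] [Group N]

/-- The fixed points in `L[N]` of the action of `Gal(L/k)` on coefficients and on `N`. -/
noncomputable def groupForm (α : (L ≃ₐ[k] L) →* MulAut N) : Subalgebra k (MonoidAlgebra L N) :=
  ⨅ g : L ≃ₐ[k] L, AlgHom.equalizer
    ((MonoidAlgebra.mapDomainAlgHom k L (α g : N →* N)).comp
      (MonoidAlgebra.mapAlgHom N (g : L →ₐ[k] L)))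
    (AlgHom.id k _)

variable (α : (L ≃ₐ[k] L) →* MulAut N)

theorem mem_groupForm_iff {x : MonoidAlgebra L N} :
    x ∈ groupForm α ↔ ∀ g n, x.coeff (α g n) = g (x.coeff n) := by
  have h (g : L ≃ₐ[k] L) (n : N) :
      ((MonoidAlgebra.mapDomainAlgHom k L (α g : N →* N)).comp
        (MonoidAlgebra.mapAlgHom N (g : L →ₐ[k] L)) x).coeff (α g n) = g (x.coeff n) := by
    have := Finsupp.mapDomain_apply (α g).injective
      (MonoidAlgebra.mapAlgHom N (g : L →ₐ[k] L) x).coeff n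
    simpa using this
  simp only [groupForm, Algebra.mem_iInf, AlgHom.mem_equalizer, AlgHom.id_apply]
  refine forall_congr' fun g => ⟨fun hx n => ?_, fun hx => ?_⟩
  · rw [← h, hx]
  · refine MonoidAlgebra.ext (Finsupp.ext fun n => ?_)
    obtain ⟨m, rfl⟩ := (α g).surjective n
    rw [h, hx]

/-- The coefficients of an element of `groupForm α`. -/
noncomputable def formCoeff : groupForm α →ₗ[k] (N → L) :=
  (coeffFun k L N).comp (groupForm α).val.toLinearMap

theorem formCoeff_apply (c : groupForm α) (n : N) :
    formCoeff α c n = (c : MonoidAlgebra L N).coeff n := rfl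

theorem formCoeff_injective : Function.Injective (formCoeff α) :=
  (coeffFun_injective k L N).comp Subtype.val_injective

theorem formCoeff_map (c : groupForm α) (g : L ≃ₐ[k] L) (n : N) :
    formCoeff α c (α g n) = g (formCoeff α c n) :=
  (mem_groupForm_iff α).1 c.2 g n

/-- The permutations of `N` underlying an action by automorphisms. -/
def autPerm : (L ≃ₐ[k] L) →* Equiv.Perm N := (MulAut.toPerm N).comp α

/-- The diagonal action on `N × N`. -/
def autPermProd : (L ≃ₐ[k] L) →* Equiv.Perm (N × N) where
  toFun g := Equiv.prodCongr (α g).toEquiv (α g).toEquiv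
  map_one' := by ext <;> simp
  map_mul' g h := by ext <;> simp

/-- The coefficients of an element of `groupForm α` are an equivariant function. -/
noncomputable def groupFormEquiv [Finite N] :
    groupForm α ≃ₗ[k] equivariantFunctions (autPerm α) :=
  LinearEquiv.ofBijective
    ((formCoeff α).codRestrict (equivariantFunctions (autPerm α)) fun x =>
      (mem_groupForm_iff α).1 x.2)
    ⟨fun _ _ h => formCoeff_injective α (congr_arg Subtype.val h),
      fun f => ⟨⟨.ofCoeff (Finsupp.equivFunOnFinite.symm f.1), (mem_groupForm_iff α).2 f.2⟩, rfl⟩⟩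

section Finite

variable [FiniteDimensional k L] [Finite N]

instance finite_groupForm : Module.Finite k (groupForm α) :=
  Module.Finite.equiv (groupFormEquiv α).symm

theorem finrank_groupForm [IsGalois k L] : Module.finrank k (groupForm α) = Nat.card N := by
  rw [(groupFormEquiv α).finrank_eq, finrank_equivariantFunctions]

end Finite

/-- The algebra map `H ⊗ H → L[N × N]` for `H = groupForm α`. -/
noncomputable def formPair : groupForm α ⊗[k] groupForm α →ₐ[k] MonoidAlgebra L (N × N) :=
  (pairHom k L N N).comp (Algebra.TensorProduct.map (groupForm α).val (groupForm α).val)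

/-- The algebra map `H ⊗ (H ⊗ H) → L[N × (N × N)]` for `H = groupForm α`. -/
noncomputable def formTriple :
    groupForm α ⊗[k] (groupForm α ⊗[k] groupForm α) →ₐ[k] MonoidAlgebra L (N × (N × N)) :=
  (pairHom k L N (N × N)).comp (Algebra.TensorProduct.map (groupForm α).val (formPair α))

theorem formPair_tmul (a b : groupForm α) : formPair α (a ⊗ₜ b) =
    (a : MonoidAlgebra L N).mapDomain (MonoidHom.inl N N) *
      (b : MonoidAlgebra L N).mapDomain (MonoidHom.inr N N) := by
  simp [formPair, pairHom_tmul]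

theorem formTriple_tmul (a : groupForm α) (w : groupForm α ⊗[k] groupForm α) :
    formTriple α (a ⊗ₜ w) =
    (a : MonoidAlgebra L N).mapDomain (MonoidHom.inl N (N × N)) *
      (formPair α w).mapDomain (MonoidHom.inr N (N × N)) := by
  simp [formTriple, pairHom_tmul]

/-- The coefficients of the image of an element of `H ⊗ H` in `L[N × N]`. -/
noncomputable def formPairCoeff : groupForm α ⊗[k] groupForm α →ₗ[k] (N × N → L) :=
  (coeffFun k L (N × N)).comp (formPair α).toLinearMap

/-- The coefficients of the image of an element of `H ⊗ (H ⊗ H)` in `L[N × (N × N)]`. -/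
noncomputable def formTripleCoeff :
    groupForm α ⊗[k] (groupForm α ⊗[k] groupForm α) →ₗ[k] (N × (N × N) → L) :=
  (coeffFun k L (N × (N × N))).comp (formTriple α).toLinearMap

theorem formPairCoeff_apply (z : groupForm α ⊗[k] groupForm α) (p : N × N) :
    formPairCoeff α z p = (formPair α z).coeff p := rfl

theorem formPairCoeff_tmul (a b : groupForm α) (x y : N) :
    formPairCoeff α (a ⊗ₜ b) (x, y) = formCoeff α a x * formCoeff α b y := by
  rw [formPairCoeff_apply, formPair_tmul, coeff_mapDomain_inl_mul_mapDomain_inr, formCoeff_apply,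
    formCoeff_apply]

theorem formTripleCoeff_tmul (a : groupForm α) (w : groupForm α ⊗[k] groupForm α)
    (x : N) (y : N × N) :
    formTripleCoeff α (a ⊗ₜ w) (x, y) = formCoeff α a x * formPairCoeff α w y := by
  change (formTriple α (a ⊗ₜ w)).coeff (x, y) = _
  rw [formTriple_tmul, coeff_mapDomain_inl_mul_mapDomain_inr, formCoeff_apply, formPairCoeff_apply]

variable [FiniteDimensional k L] [IsGalois k L]

theorem linearIndependent_groupForm {ι : Type*} [Finite ι] (b : Module.Basis ι k (groupForm α)) :
    LinearIndependent L (formCoeff α ∘ b) :=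
  linearIndependent_of_equivariant (autPerm α) (fun i => formCoeff_map α (b i))
    (b.linearIndependent.map' (formCoeff α) (LinearMap.ker_eq_bot.2 (formCoeff_injective α)))

theorem linearIndependent_formPair {ι : Type*} [Finite ι] (b : Module.Basis ι k (groupForm α)) :
    LinearIndependent L (formPairCoeff α ∘ b.tensorProduct b) :=
  linearIndependent_tensorProduct_basis (formPairCoeff_tmul α) b b
    (linearIndependent_groupForm α b) (linearIndependent_groupForm α b)

variable [Finite N]

theorem formPairCoeff_injective : Function.Injective (formPairCoeff α) :=
  let b := Module.finBasis k (groupForm α)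
  injective_of_linearIndependent_basis (b.tensorProduct b) (linearIndependent_formPair α b)

theorem formPair_injective : Function.Injective (formPair α) := fun _ _ h =>
  formPairCoeff_injective α (congr_arg (coeffFun k L (N × N)) h)

theorem formTriple_injective : Function.Injective (formTriple α) := by
  let b := Module.finBasis k (groupForm α)
  have h : Function.Injective (formTripleCoeff α) :=
    injective_of_linearIndependent_basis (b.tensorProduct (b.tensorProduct b))
      (linearIndependent_tensorProduct_basis (formTripleCoeff_tmul α) b (b.tensorProduct b)
        (linearIndependent_groupForm α b) (linearIndependent_formPair α b))
  exact fun _ _ hxy => h (congr_arg (coeffFun k L (N × (N × N))) hxy)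

/-- `H ⊗ H` is all of the invariants of `L[N × N]`: it embeds in them, and both have dimension
`|N|²`. This is what lets the comultiplication descend. -/
theorem exists_formPair_eq {x : MonoidAlgebra L (N × N)}
    (hx : ∀ g a b, x.coeff (α g a, α g b) = g (x.coeff (a, b))) : ∃ z, formPair α z = x := by
  have hφ := formPairCoeff_injective α
  have hle : LinearMap.range (formPairCoeff α) ≤ equivariantFunctions (autPermProd α) := by
    rintro _ ⟨z, rfl⟩
    induction z using TensorProduct.induction_on with
    | zero => rw [map_zero]; exact Submodule.zero_mem _
    | add z w hz hw => rw [map_add]; exact Submodule.add_mem _ hz hw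
    | tmul a b =>
      rintro g ⟨x, y⟩
      change formPairCoeff α (a ⊗ₜ b) (α g x, α g y) = g (formPairCoeff α (a ⊗ₜ b) (x, y))
      rw [formPairCoeff_tmul, formPairCoeff_tmul, formCoeff_map, formCoeff_map, map_mul]
  have : FiniteDimensional k (N × N → L) :=
    have := Fintype.ofFinite N
    inferInstance
  have heq := Submodule.eq_of_le_of_finrank_eq hle (by
    rw [LinearMap.finrank_range_of_inj hφ, Module.finrank_tensorProduct, finrank_groupForm,
      finrank_equivariantFunctions, Nat.card_prod])
  have hmem : coeffFun k L (N × N) x ∈ LinearMap.range (formPairCoeff α) := by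
    rw [heq]
    rintro g ⟨a, b⟩
    exact hx g a b
  obtain ⟨z, hz⟩ := hmem
  exact ⟨z, coeffFun_injective k L (N × N) hz⟩

end GroupForm

/-! ### The Hopf algebra structure on `L[N]^G`. -/

section HopfForm

variable {k L N : Type*} [Field k] [Field L] [Algebra k L] [Group N]

/-- The augmentation `L[N] → L`. -/
noncomputable def augmentation (k L N : Type*) [Field k] [Field L] [Algebra k L] [Group N] :
    MonoidAlgebra L N →ₐ[k] L :=
  (MonoidAlgebra.lift L L N 1).restrictScalars k

theorem augmentation_single (n : N) (r : L) :
    augmentation k L N (MonoidAlgebra.single n r) = r := by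
  simp [augmentation]

theorem mapDomain_one_eq_single_augmentation {M : Type*} [Group M] (x : MonoidAlgebra L N) :
    x.mapDomain (fun _ => (1 : M)) = MonoidAlgebra.single 1 (augmentation k L N x) := by
  induction x using MonoidAlgebra.induction_linear with
  | zero => simp
  | add x y hx hy => rw [MonoidAlgebra.mapDomain_add, hx, hy, map_add, MonoidAlgebra.single_add]
  | single n r => rw [MonoidAlgebra.mapDomain_single, augmentation_single]

theorem mapDomain_mapDomain {A B C : Type*} (f : A → B) (g : B → C) (x : MonoidAlgebra L A) :
    (x.mapDomain f).mapDomain g = x.mapDomain (g ∘ f) :=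
  MonoidAlgebra.ext Finsupp.mapDomain_comp.symm

/-- With this, structure maps on tensors become `mapDomain` along maps of points, so that each Hopf
axiom reduces to an identity between maps out of `N`. -/
theorem mapDomain_inl_mul_inr {A B C : Type*} [Group A] [Group B] [Group C] (u : A → C) (v : B → C)
    (x : MonoidAlgebra L A) (y : MonoidAlgebra L B) :
    (x.mapDomain (MonoidHom.inl A B) * y.mapDomain (MonoidHom.inr A B)).mapDomain
      (fun p => u p.1 * v p.2) = x.mapDomain u * y.mapDomain v := by
  induction x using MonoidAlgebra.induction_linear with
  | zero => simp
  | add x x' hx hx' => simp only [MonoidAlgebra.mapDomain_add, add_mul, hx, hx']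
  | single m r =>
    induction y using MonoidAlgebra.induction_linear with
    | zero => simp
    | add y y' hy hy' => simp only [MonoidAlgebra.mapDomain_add, mul_add, hy, hy']
    | single n s => simp [MonoidAlgebra.single_mul_single]

theorem mapDomain_id_eq {A : Type*} (x : MonoidAlgebra L A) : x.mapDomain (fun n => n) = x :=
  MonoidAlgebra.ext Finsupp.mapDomain_id

variable (α : (L ≃ₐ[k] L) →* MulAut N)

theorem mapDomain_formPair_tmul {C : Type*} [Group C] (u v : N → C) (a b : groupForm α) :
    (formPair α (a ⊗ₜ b)).mapDomain (fun p => u p.1 * v p.2) =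
      (a : MonoidAlgebra L N).mapDomain u * (b : MonoidAlgebra L N).mapDomain v := by
  rw [formPair_tmul, mapDomain_inl_mul_inr]

/-- The antipode of `groupForm α`, given by inversion on `N`. -/
noncomputable def formAntipode : groupForm α →ₗ[k] groupForm α :=
  ((MonoidAlgebra.mapDomainLinearMap k L (fun n : N => n⁻¹)).comp
    (groupForm α).val.toLinearMap).codRestrict (Subalgebra.toSubmodule (groupForm α)) fun c => by
      refine (mem_groupForm_iff α).2 fun g n => ?_
      have h (m : N) : (MonoidAlgebra.mapDomainLinearMap k L (fun n : N => n⁻¹)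
          (c : MonoidAlgebra L N)).coeff m = (c : MonoidAlgebra L N).coeff m⁻¹ := by
        have := Finsupp.mapDomain_apply inv_injective (c : MonoidAlgebra L N).coeff m⁻¹
        rwa [inv_inv] at this
      change (MonoidAlgebra.mapDomainLinearMap k L (fun n : N => n⁻¹)
        (c : MonoidAlgebra L N)).coeff (α g n) = g ((MonoidAlgebra.mapDomainLinearMap k L
          (fun n : N => n⁻¹) (c : MonoidAlgebra L N)).coeff n)
      rw [h, h, ← map_inv, (mem_groupForm_iff α).1 c.2]

theorem formTriple_assoc_tmul (w : groupForm α ⊗[k] groupForm α) (b : groupForm α) :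
    formTriple α (Algebra.TensorProduct.assoc k k k (groupForm α) (groupForm α) (groupForm α)
      (w ⊗ₜ b)) = (formPair α w).mapDomain (fun p => (p.1, (p.2, 1))) *
        (b : MonoidAlgebra L N).mapDomain (fun n => (1, (1, n))) := by
  induction w using TensorProduct.induction_on with
  | zero => simp
  | add z w hz hw => simp only [map_add, MonoidAlgebra.mapDomain_add, TensorProduct.add_tmul,
      add_mul, ← hz, ← hw]
  | tmul a c =>
    have h := mapDomain_formPair_tmul α (fun n => (n, ((1 : N), (1 : N))))
      (fun n => ((1 : N), (n, (1 : N)))) a c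
    simp only [Prod.mk_mul_mk, mul_one, one_mul] at h
    rw [h, Algebra.TensorProduct.assoc_tmul, formTriple_tmul, formPair_tmul]
    have h2 := MonoidAlgebra.mapDomain_mul (MonoidHom.inr N (N × N))
      ((c : MonoidAlgebra L N).mapDomain (MonoidHom.inl N N))
      ((b : MonoidAlgebra L N).mapDomain (MonoidHom.inr N N))
    rw [h2, mapDomain_mapDomain, mapDomain_mapDomain, mul_assoc]
    rfl

theorem formPair_comm (z : groupForm α ⊗[k] groupForm α) :
    formPair α (TensorProduct.comm k (groupForm α) (groupForm α) z) =
      (formPair α z).mapDomain (fun p => (1, p.1) * (p.2, 1)) := by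
  induction z using TensorProduct.induction_on with
  | zero => simp
  | add z w hz hw => simp only [map_add, MonoidAlgebra.mapDomain_add, ← hz, ← hw]
  | tmul a b =>
    rw [mapDomain_formPair_tmul α (fun n => ((1 : N), n)) (fun n => (n, (1 : N)))]
    rw [TensorProduct.comm_tmul, formPair_tmul]
    exact commute_mapDomain_inl_inr _ _

theorem coe_mul_antipode_rTensor (z : groupForm α ⊗[k] groupForm α) :
    (LinearMap.mul' k (groupForm α) ((formAntipode α).rTensor _ z) : MonoidAlgebra L N) =
      (formPair α z).mapDomain (fun p => p.1⁻¹ * p.2) := by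
  induction z using TensorProduct.induction_on with
  | zero => simp
  | add z w hz hw => simp only [map_add, MonoidAlgebra.mapDomain_add, ← hz, ← hw]; rfl
  | tmul a b =>
    refine Eq.trans ?_ (mapDomain_formPair_tmul α (fun n => n⁻¹) (fun n => n) a b).symm
    rw [mapDomain_id_eq, LinearMap.rTensor_tmul, LinearMap.mul'_apply]
    rfl

theorem coe_mul_antipode_lTensor (z : groupForm α ⊗[k] groupForm α) :
    (LinearMap.mul' k (groupForm α) ((formAntipode α).lTensor _ z) : MonoidAlgebra L N) =
      (formPair α z).mapDomain (fun p => p.1 * p.2⁻¹) := by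
  induction z using TensorProduct.induction_on with
  | zero => simp
  | add z w hz hw => simp only [map_add, MonoidAlgebra.mapDomain_add, ← hz, ← hw]; rfl
  | tmul a b =>
    refine Eq.trans ?_ (mapDomain_formPair_tmul α (fun n => n) (fun n => n⁻¹) a b).symm
    rw [mapDomain_id_eq, LinearMap.lTensor_tmul, LinearMap.mul'_apply]
    rfl

variable [FiniteDimensional k L] [IsGalois k L] [Finite N]

/-- The diagonal of `N × N` and its complement are stable under `α g × α g`, so the pushforward of
`c` along the diagonal is again invariant. -/
theorem exists_formPair_eq_diag (c : groupForm α) :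
    ∃ z, formPair α z = (c : MonoidAlgebra L N).mapDomain (fun n => (n, n)) := by
  refine exists_formPair_eq α fun g a b => ?_
  have hinj : Function.Injective (fun n : N => (n, n)) := fun _ _ h => congr_arg Prod.fst h
  by_cases h : a = b
  · subst h
    exact (Finsupp.mapDomain_apply hinj _ _).trans
      (((mem_groupForm_iff α).1 c.2 g a).trans
        (congr_arg g (Finsupp.mapDomain_apply hinj _ _).symm))
  · have h1 : (a, b) ∉ Set.range (fun n : N => (n, n)) := by
      rintro ⟨n, hn⟩
      exact h ((congr_arg Prod.fst hn).symm.trans (congr_arg Prod.snd hn))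
    have h2 : (α g a, α g b) ∉ Set.range (fun n : N => (n, n)) := by
      rintro ⟨n, hn⟩
      exact h ((α g).injective ((congr_arg Prod.fst hn).symm.trans (congr_arg Prod.snd hn)))
    exact (Finsupp.mapDomain_of_notMem_range _ _ h2).trans
      ((map_zero g).symm.trans (congr_arg g (Finsupp.mapDomain_of_notMem_range _ _ h1).symm))

/-- The diagonal homomorphism `N → N × N`. -/
def diagHom (N : Type*) [Group N] : N →* N × N := (MonoidHom.id N).prod (MonoidHom.id N)

/-- The comultiplication of `groupForm α`, given by `n ↦ n ⊗ n` on `N`. -/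
noncomputable def formComul : groupForm α →ₐ[k] groupForm α ⊗[k] groupForm α :=
  (AlgEquiv.ofInjective (formPair α) (formPair_injective α)).symm.toAlgHom.comp
    (((MonoidAlgebra.mapDomainAlgHom k L (diagHom N)).comp (groupForm α).val).codRestrict
      (formPair α).range fun c => exists_formPair_eq_diag α c)

theorem formPair_formComul (c : groupForm α) :
    formPair α (formComul α c) = (c : MonoidAlgebra L N).mapDomain (fun n => (n, n)) :=
  congr_arg Subtype.val
    ((AlgEquiv.ofInjective (formPair α) (formPair_injective α)).apply_symm_apply _)

theorem mapDomain_formPair_formComul {A : Type*} (f : N × N → A) (c : groupForm α) :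
    (formPair α (formComul α c)).mapDomain f =
      (c : MonoidAlgebra L N).mapDomain (fun n => f (n, n)) := by
  rw [formPair_formComul, mapDomain_mapDomain]
  rfl

/-- Each `g` only permutes the coefficients of `c` along `α g`, so their sum is Galois-fixed. -/
theorem augmentation_mem_bot (c : groupForm α) :
    augmentation k L N (c : MonoidAlgebra L N) ∈ (⊥ : Subalgebra k L) := by
  have := Fintype.ofFinite N
  rw [Algebra.mem_bot, IsGalois.mem_range_algebraMap_iff_fixed]
  intro g
  have h : ∀ x : MonoidAlgebra L N, augmentation k L N x = ∑ n, x.coeff n := fun x => by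
    simp only [augmentation, AlgHom.restrictScalars_apply, MonoidAlgebra.lift_apply]
    rw [Finsupp.sum_fintype _ _ (by simp)]
    simp
  rw [h, map_sum, ← Equiv.sum_comp (α g).toEquiv (fun n => (c : MonoidAlgebra L N).coeff n)]
  exact Finset.sum_congr rfl fun n _ => ((mem_groupForm_iff α).1 c.2 g n).symm

/-- The counit of `groupForm α`: the sum of the coefficients. -/
noncomputable def formCounit : groupForm α →ₐ[k] k :=
  (Algebra.botEquiv k L).toAlgHom.comp
    (((augmentation k L N).comp (groupForm α).val).codRestrict ⊥ (augmentation_mem_bot α))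

theorem algebraMap_formCounit (c : groupForm α) :
    algebraMap k L (formCounit α c) = augmentation k L N (c : MonoidAlgebra L N) := by
  have h := (Algebra.botEquiv k L).symm_apply_apply ⟨_, augmentation_mem_bot α c⟩
  rw [Algebra.botEquiv_symm_apply] at h
  exact congr_arg Subtype.val h

theorem mapDomain_one_eq_algebraMap (c : groupForm α) :
    (c : MonoidAlgebra L N).mapDomain (fun _ => (1 : N)) =
      algebraMap k (MonoidAlgebra L N) (formCounit α c) := by
  rw [mapDomain_one_eq_single_augmentation (k := k), ← algebraMap_formCounit]
  simp

theorem coe_lid_map_formCounit (z : groupForm α ⊗[k] groupForm α) :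
    (Algebra.TensorProduct.lid k (groupForm α)
      (Algebra.TensorProduct.map (formCounit α) (.id k (groupForm α)) z) : MonoidAlgebra L N) =
    (formPair α z).mapDomain (fun p => 1 * p.2) := by
  induction z using TensorProduct.induction_on with
  | zero => simp
  | add z w hz hw => simp only [map_add, MonoidAlgebra.mapDomain_add, ← hz, ← hw]; rfl
  | tmul a b =>
    refine Eq.trans ?_ (mapDomain_formPair_tmul α (fun _ => 1) (fun n => n) a b).symm
    rw [mapDomain_one_eq_algebraMap, ← Algebra.smul_def, mapDomain_id_eq,
      Algebra.TensorProduct.map_tmul, Algebra.TensorProduct.lid_tmul]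
    rfl

theorem coe_rid_map_formCounit (z : groupForm α ⊗[k] groupForm α) :
    (Algebra.TensorProduct.rid k k (groupForm α)
      (Algebra.TensorProduct.map (.id k (groupForm α)) (formCounit α) z) : MonoidAlgebra L N) =
    (formPair α z).mapDomain (fun p => p.1 * 1) := by
  induction z using TensorProduct.induction_on with
  | zero => simp
  | add z w hz hw => simp only [map_add, MonoidAlgebra.mapDomain_add, ← hz, ← hw]; rfl
  | tmul a b =>
    refine Eq.trans ?_ (mapDomain_formPair_tmul α (fun n => n) (fun _ => 1) a b).symm
    rw [mapDomain_one_eq_algebraMap, ← Algebra.commutes, ← Algebra.smul_def, mapDomain_id_eq,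
      Algebra.TensorProduct.map_tmul, Algebra.TensorProduct.rid_tmul]
    rfl

theorem formTriple_map_formComul (z : groupForm α ⊗[k] groupForm α) :
    formTriple α (Algebra.TensorProduct.map (.id k (groupForm α)) (formComul α) z) =
      (formPair α z).mapDomain (fun p => (p.1, (1, 1)) * (1, (p.2, p.2))) := by
  induction z using TensorProduct.induction_on with
  | zero => simp
  | add z w hz hw => simp only [map_add, MonoidAlgebra.mapDomain_add, ← hz, ← hw]
  | tmul a b =>
    rw [mapDomain_formPair_tmul α (fun n => (n, ((1 : N), (1 : N)))) (fun n => ((1 : N), (n, n)))]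
    rw [Algebra.TensorProduct.map_tmul, formTriple_tmul, formPair_formComul, mapDomain_mapDomain]
    rfl

theorem formTriple_assoc_map_formComul (z : groupForm α ⊗[k] groupForm α) :
    formTriple α (Algebra.TensorProduct.assoc k k k (groupForm α) (groupForm α) (groupForm α)
      (Algebra.TensorProduct.map (formComul α) (.id k (groupForm α)) z)) =
      (formPair α z).mapDomain (fun p => (p.1, (p.1, 1)) * (1, (1, p.2))) := by
  induction z using TensorProduct.induction_on with
  | zero => simp
  | add z w hz hw => simp only [map_add, MonoidAlgebra.mapDomain_add, ← hz, ← hw]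
  | tmul a b =>
    rw [mapDomain_formPair_tmul α (fun n => (n, (n, (1 : N)))) (fun n => ((1 : N), ((1 : N), n)))]
    rw [Algebra.TensorProduct.map_tmul, formTriple_assoc_tmul, formPair_formComul,
      mapDomain_mapDomain]
    rfl

/-- After the injection `formTriple`, both sides of coassociativity are the pushforward along `n ↦
(n, (n, n))`. Both counit laws become the pushforward along the identity. -/
noncomputable instance bialgebraGroupForm : Bialgebra k (groupForm α) :=
  Bialgebra.ofAlgHom (formComul α) (formCounit α)
    (by
      refine AlgHom.ext fun c => formTriple_injective α ?_
      refine (formTriple_assoc_map_formComul α _).trans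
        (Eq.trans ?_ (formTriple_map_formComul α _).symm)
      refine (mapDomain_formPair_formComul α _ c).trans
        (Eq.trans ?_ (mapDomain_formPair_formComul α _ c).symm)
      simp only [Prod.mk_mul_mk, mul_one, one_mul])
    (by
      refine AlgHom.ext fun c => (Algebra.TensorProduct.lid k (groupForm α)).injective
        (Subtype.ext ((coe_lid_map_formCounit α _).trans ?_))
      refine (mapDomain_formPair_formComul α _ c).trans ?_
      simp only [one_mul]
      refine (mapDomain_id_eq _).trans (congr_arg Subtype.val ?_)
      exact ((Algebra.TensorProduct.lid k (groupForm α)).apply_symm_apply c).symm)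
    (by
      refine AlgHom.ext fun c => (Algebra.TensorProduct.rid k k (groupForm α)).injective
        (Subtype.ext ((coe_rid_map_formCounit α _).trans ?_))
      refine (mapDomain_formPair_formComul α _ c).trans ?_
      simp only [mul_one]
      refine (mapDomain_id_eq _).trans (congr_arg Subtype.val ?_)
      exact ((Algebra.TensorProduct.rid k k (groupForm α)).apply_symm_apply c).symm)

theorem comul_groupForm (c : groupForm α) : Coalgebra.comul (R := k) c = formComul α c := rfl

theorem counit_groupForm (c : groupForm α) : Coalgebra.counit (R := k) c = formCounit α c := rfl

noncomputable instance hopfAlgebraGroupForm : HopfAlgebra k (groupForm α) where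
  antipode := formAntipode α
  mul_antipode_rTensor_comul := by
    refine LinearMap.ext fun c => Subtype.ext ((coe_mul_antipode_rTensor α _).trans ?_)
    refine (mapDomain_formPair_formComul α _ c).trans ?_
    simp only [inv_mul_cancel]
    exact mapDomain_one_eq_algebraMap α c
  mul_antipode_lTensor_comul := by
    refine LinearMap.ext fun c => Subtype.ext ((coe_mul_antipode_lTensor α _).trans ?_)
    refine (mapDomain_formPair_formComul α _ c).trans ?_
    simp only [mul_inv_cancel]
    exact mapDomain_one_eq_algebraMap α c

instance isCocomm_groupForm : Coalgebra.IsCocomm k (groupForm α) where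
  comm_comp_comul := by
    refine LinearMap.ext fun c => formPair_injective α ((formPair_comm α _).trans ?_)
    refine (mapDomain_formPair_formComul α _ c).trans (Eq.trans ?_ (formPair_formComul α c).symm)
    simp only [Prod.mk_mul_mk, mul_one, one_mul]

end HopfForm

/-! ### Translation of functions on a group. -/

section RegularRepresentation

/-- The left regular representation of `M` on functions, `(m • f) n = f (m⁻¹ * n)`, extended to the
group algebra. -/
noncomputable def functionRep (L M : Type*) [Field L] [Group M] :
    MonoidAlgebra L M →ₐ[L] Module.End L (M → L) :=
  MonoidAlgebra.lift L _ M
    { toFun := fun m => LinearMap.funLeft L L (fun n => m⁻¹ * n)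
      map_one' := by ext; simp
      map_mul' := fun a b => by
        refine LinearMap.ext fun f => funext fun n => ?_
        simp [LinearMap.funLeft_apply, mul_assoc] }

variable {L M : Type*} [Field L] [Group M]

theorem functionRep_single (m : M) (r : L) (f : M → L) (n : M) :
    functionRep L M (MonoidAlgebra.single m r) f n = r * f (m⁻¹ * n) := by
  simp [functionRep, LinearMap.funLeft_apply]

theorem functionRep_apply [Fintype M] (x : MonoidAlgebra L M) (f : M → L) (n : M) :
    functionRep L M x f n = ∑ m, x.coeff m * f (m⁻¹ * n) := by
  classical
  induction x using MonoidAlgebra.induction_linear with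
  | zero => simp
  | add x y hx hy => simp [hx, hy, add_mul, Finset.sum_add_distrib]
  | single m r =>
    rw [functionRep_single, Finset.sum_eq_single m] <;> simp +contextual [eq_comm]

theorem functionRep_one {k : Type*} [Field k] [Algebra k L] (x : MonoidAlgebra L M) (n : M) :
    functionRep L M x 1 n = augmentation k L M x := by
  induction x using MonoidAlgebra.induction_linear with
  | zero => simp
  | add x y hx hy => rw [map_add, map_add, LinearMap.add_apply, Pi.add_apply, hx, hy]
  | single m r => rw [functionRep_single, augmentation_single, Pi.one_apply, mul_one]

/-- Translations are multiplicative on functions, which is the module algebra law for the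
comultiplication `m ↦ m ⊗ m`. -/
theorem functionRep_mapDomain_diag (x : MonoidAlgebra L M) (f g : M → L) (n : M) :
    functionRep L (M × M) (x.mapDomain (fun m => (m, m))) (fun p => f p.1 * g p.2) (n, n) =
      functionRep L M x (f * g) n := by
  induction x using MonoidAlgebra.induction_linear with
  | zero => simp
  | add x y hx hy =>
    rw [MonoidAlgebra.mapDomain_add, map_add, map_add, LinearMap.add_apply, LinearMap.add_apply,
      Pi.add_apply, Pi.add_apply, hx, hy]
  | single m r =>
    rw [MonoidAlgebra.mapDomain_single, functionRep_single, functionRep_single]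
    rfl

end RegularRepresentation

/-! ### From an action in the holomorph to a Hopf Galois structure. -/

section HopfGaloisForm

variable {k L : Type*} [Field k] [Field L] [Algebra k L]

/-- A transitive action `β` of `Gal(L/k)` on a group `N` through the holomorph of `N`, in which the
stabilizer of the identity is `Gal(L/F)`; `α` gives the automorphism parts. -/
structure HolomorphAction (F : IntermediateField k L) (N : Type*) [Group N] where
  α : (L ≃ₐ[k] L) →* MulAut N
  β : (L ≃ₐ[k] L) →* Equiv.Perm N
  β_mul : ∀ g n m, β g (n * m) = α g n * β g m
  exists_eq : ∀ n, ∃ g, β g 1 = n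
  stabilizer : ∀ g, β g 1 = 1 ↔ g ∈ F.fixingSubgroup

namespace HolomorphAction

variable {F : IntermediateField k L} {N : Type*} [Group N] (D : HolomorphAction F N)

/-- The embedding of `F` in `L` attached to an element of `N`. -/
noncomputable def emb (n : N) : F →ₐ[k] L :=
  ((D.exists_eq n).choose : L →ₐ[k] L).comp F.val

/-- Two choices of `g` differ by an element stabilizing 1, which fixes `F`. -/
theorem emb_eq {g : L ≃ₐ[k] L} {n : N} (h : D.β g 1 = n) (s : F) : D.emb n s = g s := by
  set g₀ := (D.exists_eq n).choose
  have h₀ : D.β g₀ 1 = n := (D.exists_eq n).choose_spec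
  have h1 : g⁻¹ * g₀ ∈ F.fixingSubgroup := by
    rw [← D.stabilizer, map_mul, Equiv.Perm.mul_apply, h₀, ← h, map_inv]
    exact (D.β g).symm_apply_apply 1
  have h2 := (IntermediateField.mem_fixingSubgroup_iff F _).1 h1 s s.2
  change g₀ (s : L) = g s
  conv_rhs => rw [← h2]
  rw [AlgEquiv.mul_apply, ← AlgEquiv.mul_apply, mul_inv_cancel, AlgEquiv.one_apply]

theorem emb_one (s : F) : D.emb 1 s = s := D.emb_eq (g := 1) (by simp) s

theorem emb_map (g : L ≃ₐ[k] L) (n : N) (s : F) : D.emb (D.β g n) s = g (D.emb n s) := by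
  obtain ⟨h, rfl⟩ := D.exists_eq n
  rw [D.emb_eq rfl, ← Equiv.Perm.mul_apply, ← map_mul, D.emb_eq rfl, AlgEquiv.mul_apply]

theorem emb_injective : Function.Injective D.emb := by
  intro n m h
  obtain ⟨g, rfl⟩ := D.exists_eq n
  obtain ⟨g', rfl⟩ := D.exists_eq m
  have h1 : g⁻¹ * g' ∈ F.fixingSubgroup := by
    refine (IntermediateField.mem_fixingSubgroup_iff F _).2 fun x hx => ?_
    have h2 := DFunLike.congr_fun h ⟨x, hx⟩
    rw [D.emb_eq rfl, D.emb_eq rfl] at h2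
    rw [AlgEquiv.mul_apply, ← h2, ← AlgEquiv.mul_apply, inv_mul_cancel, AlgEquiv.one_apply]
  rw [← D.stabilizer, map_mul, Equiv.Perm.mul_apply, map_inv, Equiv.Perm.inv_eq_iff_eq] at h1
  exact h1.symm

theorem linearIndependent_emb : LinearIndependent L (fun n : N => (D.emb n : F → L)) :=
  (linearIndependent_monoidHom F L).comp (fun n => (D.emb n : F →* L)) fun _ _ h =>
    D.emb_injective (AlgHom.ext fun s => DFunLike.congr_fun h s)

/-- The conjugates of an element of `F`, as a function on `N`. -/
noncomputable def conjugates : F →ₗ[k] (N → L) := LinearMap.pi fun n => (D.emb n).toLinearMap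

theorem conjugates_apply (s : F) (n : N) : D.conjugates s n = D.emb n s := rfl

theorem conjugates_injective : Function.Injective D.conjugates := fun s t h => by
  have := congr_fun h 1
  rwa [conjugates_apply, conjugates_apply, D.emb_one, D.emb_one, SetLike.coe_eq_coe] at this

theorem conjugates_mul (s t : F) : D.conjugates (s * t) = D.conjugates s * D.conjugates t :=
  funext fun n => map_mul (D.emb n) s t

theorem conjugates_one : D.conjugates 1 = 1 := funext fun n => map_one (D.emb n)

/-- Reindexing the sum by `α g` uses `β_g(m⁻¹ n) = α_g(m)⁻¹ β_g(n)`: this is where the holomorph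
condition enters. -/
theorem map_functionRep [Finite N] (c : groupForm D.α) (s : F) (g : L ≃ₐ[k] L) (n : N) :
    g (functionRep L N c (D.conjugates s) n) = functionRep L N c (D.conjugates s) (D.β g n) := by
  have := Fintype.ofFinite N
  rw [functionRep_apply, functionRep_apply, map_sum,
    ← Equiv.sum_comp (D.α g).toEquiv (fun m => _ * D.conjugates s (m⁻¹ * D.β g n))]
  refine Finset.sum_congr rfl fun m _ => ?_
  change _ = (c : MonoidAlgebra L N).coeff (D.α g m) * D.conjugates s ((D.α g m)⁻¹ * D.β g n)
  rw [(mem_groupForm_iff D.α).1 c.2, ← map_inv, ← D.β_mul, conjugates_apply, conjugates_apply,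
    D.emb_map, map_mul]

variable [FiniteDimensional k L] [IsGalois k L] [Finite N]

theorem functionRep_mem (c : groupForm D.α) (s : F) :
    functionRep L N c (D.conjugates s) 1 ∈ F := by
  have h : functionRep L N c (D.conjugates s) 1 ∈
      IntermediateField.fixedField F.fixingSubgroup := by
    rintro ⟨g, hg⟩
    exact (D.map_functionRep c s g 1).trans (by rw [(D.stabilizer g).2 hg])
  rwa [IsGalois.fixedField_fixingSubgroup F] at h

/-- The action of `groupForm D.α` on `F`, as a bilinear map. -/
noncomputable def actionLinear : groupForm D.α →ₗ[k] Module.End k F :=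
  LinearMap.mk₂ k (fun c s => ⟨functionRep L N c (D.conjugates s) 1, D.functionRep_mem c s⟩)
    (fun c c' s => Subtype.ext (by simp))
    (fun r c s => Subtype.ext (congr_fun (LinearMap.congr_fun
      (map_smul ((functionRep L N).restrictScalars k) r (c : MonoidAlgebra L N)) _) 1))
    (fun c s t => Subtype.ext (by simp))
    (fun r c s => Subtype.ext (congr_fun
      ((congr_arg (functionRep L N c) (map_smul D.conjugates r s)).trans
        (LinearMap.map_smul_of_tower _ r _)) 1))

/-- The action is defined by its value at 1. Both sides are equivariant under the transitive `β`, so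
agreement at 1 suffices. -/
theorem conjugates_actionLinear (c : groupForm D.α) (s : F) :
    D.conjugates (D.actionLinear c s) = functionRep L N c (D.conjugates s) := by
  funext n
  obtain ⟨g, rfl⟩ := D.exists_eq n
  rw [← map_functionRep, conjugates_apply, D.emb_eq rfl]
  rfl

/-- The action of `groupForm D.α` on `F`. -/
noncomputable def action : groupForm D.α →ₐ[k] Module.End k F :=
  AlgHom.ofLinearMap D.actionLinear
    (LinearMap.ext fun s => D.conjugates_injective (by
      rw [conjugates_actionLinear, OneMemClass.coe_one, map_one]
      rfl))
    (fun c c' => LinearMap.ext fun s => D.conjugates_injective (by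
      rw [conjugates_actionLinear, MulMemClass.coe_mul, map_mul, Module.End.mul_apply,
        Module.End.mul_apply, conjugates_actionLinear, conjugates_actionLinear]))

theorem conjugates_action (c : groupForm D.α) (s : F) :
    D.conjugates (D.action c s) = functionRep L N c (D.conjugates s) :=
  D.conjugates_actionLinear c s

theorem coe_action [Fintype N] (c : groupForm D.α) (s : F) :
    (D.action c s : L) = ∑ ν, formCoeff D.α c ν * D.emb ν⁻¹ s := by
  rw [← D.emb_one, ← conjugates_apply, conjugates_action, functionRep_apply]
  simp only [mul_one]
  rfl

theorem conjugates_mul_map_action (z : groupForm D.α ⊗[k] groupForm D.α) (s t : F) (n : N) :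
    D.conjugates (LinearMap.mul' k F (TensorProduct.map (D.action.toLinearMap.flip s)
      (D.action.toLinearMap.flip t) z)) n =
    functionRep L (N × N) (formPair D.α z) (fun p => D.conjugates s p.1 * D.conjugates t p.2)
      (n, n) := by
  have := Fintype.ofFinite N
  induction z using TensorProduct.induction_on with
  | zero => simp
  | add z w hz hw => simp only [map_add, Pi.add_apply, LinearMap.add_apply, hz, hw]
  | tmul a b =>
    rw [TensorProduct.map_tmul, LinearMap.mul'_apply, conjugates_mul, Pi.mul_apply]
    change D.conjugates (D.action a s) n * D.conjugates (D.action b t) n = _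
    rw [conjugates_action, conjugates_action, functionRep_apply, functionRep_apply,
      functionRep_apply, Finset.sum_mul_sum, Fintype.sum_prod_type]
    refine Finset.sum_congr rfl fun x _ => Finset.sum_congr rfl fun y _ => ?_
    have h := formPairCoeff_tmul D.α a b x y
    rw [formPairCoeff_apply, formCoeff_apply, formCoeff_apply] at h
    rw [h]
    exact mul_mul_mul_comm _ _ _ _

theorem isModuleAlgebra_action : IsModuleAlgebra D.action where
  map_one c := D.conjugates_injective (by
    funext n
    rw [conjugates_action, conjugates_one, functionRep_one (k := k), counit_groupForm,
      conjugates_apply, AlgHom.commutes, algebraMap_formCounit])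
  map_mul c s t := D.conjugates_injective (by
    funext n
    rw [conjugates_mul_map_action, comul_groupForm, formPair_formComul, functionRep_mapDomain_diag,
      conjugates_action, conjugates_mul])

/-- Write an element of the kernel as `∑ cᵢ ⊗ bᵢ`. Dedekind independence of the embeddings `emb ν⁻¹`
gives `∑ cᵢ bᵢ(ν) = 0` for each `ν`, and the `bᵢ` stay independent over `L`. -/
theorem hopfGaloisMap_action_injective : Function.Injective (hopfGaloisMap D.action) := by
  have := Fintype.ofFinite N
  rw [injective_iff_map_eq_zero]
  intro z hz
  let b := Module.finBasis k (groupForm D.α)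
  obtain ⟨c, rfl⟩ := TensorProduct.eq_repr_basis_right b z
  rw [Finsupp.sum_fintype _ _ (by simp)] at hz ⊢
  have h1 : ∀ ν, ∑ i, (c i : L) * formCoeff D.α (b i) ν = 0 := by
    have h2 := Fintype.linearIndependent_iff.1
      (D.linearIndependent_emb.comp (fun n : N => n⁻¹) inv_injective)
      (fun ν => ∑ i, (c i : L) * formCoeff D.α (b i) ν)
    refine h2 (funext fun t => ?_)
    have h3 := congr_arg (fun φ : Module.End k F => F.val (φ t)) hz
    simp only [map_sum, LinearMap.sum_apply, hopfGaloisMap_tmul, LinearMap.zero_apply,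
      map_zero, map_mul, IntermediateField.coe_val, coe_action] at h3
    simp only [Finset.sum_apply, Pi.smul_apply, smul_eq_mul, Pi.zero_apply, Function.comp_apply,
      Finset.sum_mul]
    rw [← h3, Finset.sum_comm]
    refine Finset.sum_congr rfl fun i _ => ?_
    rw [Finset.mul_sum]
    exact Finset.sum_congr rfl fun ν _ => mul_assoc _ _ _
  have h4 := Fintype.linearIndependent_iff.1 (linearIndependent_groupForm D.α b)
    (fun i => (c i : L)) (funext fun ν => by simpa using h1 ν)
  refine Finset.sum_eq_zero fun i _ => ?_
  rw [show c i = 0 from Subtype.ext (h4 i), TensorProduct.zero_tmul]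

end HolomorphAction

theorem isHopfGalois_of_holomorphAction.{u, v} {k : Type u} {L : Type v} [Field k] [Field L]
    [Algebra k L] [FiniteDimensional k L] [IsGalois k L] {F : IntermediateField k L} {N : Type}
    [Group N] [Finite N] (D : HolomorphAction F N) (hN : Nat.card N = Module.finrank k F) :
    IsHopfGalois k F := by
  refine ⟨groupForm D.α, inferInstance, inferInstance, inferInstance, inferInstance, D.action,
    D.isModuleAlgebra_action, D.hopfGaloisMap_action_injective, ?_⟩
  -- Both sides have dimension `[F : k]²`, because `dim H = |N| = [F : k]`.
  refine (LinearMap.injective_iff_surjective_of_finrank_eq_finrank ?_).1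
    D.hopfGaloisMap_action_injective
  rw [Module.finrank_tensorProduct, finrank_groupForm, hN, Module.finrank_linearMap]

end HopfGaloisForm

/-! ### Regular subgroups of coset actions, and the holomorph. -/

section RegularSubgroups

variable {G : Type*} [Group G] {P : Subgroup G}

theorem cosetPermHom_apply_mk (g x : G) :
    cosetPermHom P g (x : G ⧸ P) = ((g * x : G) : G ⧸ P) := rfl

theorem exists_regular_of_sign (χ : G →* ℤˣ) (h1 : ∀ h ∈ P, χ h = 1 → h = 1)
    (h2 : ∃ h ∈ P, χ h = -1) :
    ∃ N : Subgroup (Equiv.Perm (G ⧸ P)), IsRegularSubgroup N ∧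
      (cosetPermHom P).range ≤ Subgroup.normalizer (N : Set _) ∧ N ≤ (cosetPermHom P).range := by
  refine ⟨χ.ker.map (cosetPermHom P), fun x y => ?_, ?_, Subgroup.map_le_range _ _⟩
  · induction x using QuotientGroup.induction_on with | H x =>
    induction y using QuotientGroup.induction_on with | H y =>
    obtain ⟨z, hz, hz1⟩ := h2
    -- If `y * x⁻¹` has the wrong sign, replacing `y` by `y * z` corrects it without leaving the
    -- coset.
    have hex : ∃ m, χ m = 1 ∧ ((m * x : G) : G ⧸ P) = y := by
      rcases Int.units_eq_one_or (χ (y * x⁻¹)) with h | h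
      · exact ⟨y * x⁻¹, h, by simp⟩
      · refine ⟨y * z * x⁻¹, ?_, ?_⟩
        · rw [map_mul, map_mul, hz1, mul_right_comm, ← map_mul, h]
          simp
        · rw [inv_mul_cancel_right, QuotientGroup.eq]
          simpa using P.inv_mem hz
    obtain ⟨m, hm, hmx⟩ := hex
    refine ⟨cosetPermHom P m, ⟨⟨m, hm, rfl⟩, hmx⟩, ?_⟩
    rintro _ ⟨⟨m', hm', rfl⟩, hmx'⟩
    rw [cosetPermHom_apply_mk, ← hmx, QuotientGroup.eq] at hmx'
    have h3 := h1 _ hmx' (by simp [MonoidHom.mem_ker.1 hm', hm])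
    rw [inv_mul_eq_one, mul_left_inj] at h3
    rw [h3]
  · rintro _ ⟨g, rfl⟩
    have key : ∀ g, ∀ σ ∈ χ.ker.map (cosetPermHom P),
        cosetPermHom P g * σ * (cosetPermHom P g)⁻¹ ∈ χ.ker.map (cosetPermHom P) := by
      rintro g _ ⟨m, hm, rfl⟩
      exact ⟨g * m * g⁻¹, (MonoidHom.normal_ker χ).conj_mem m hm g, by simp⟩
    refine Subgroup.mem_normalizer_iff.2 fun σ => ⟨key g σ, fun h => ?_⟩
    have h' := key g⁻¹ _ h
    rw [map_inv] at h'
    simpa [mul_assoc] using h'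

/-- Transitivity of `N` gives `g = m h` with `m` in the normal preimage `M` of `N` and `h ∈ P`;
modulo `M`, `g ^ 3 = h ^ 3 = 1`. Hence `M = G`, so each element of `P` acts as an element of `N`
with a fixed point, that is, trivially. -/
theorem normal_of_regular_of_cubes (hP : ∀ h ∈ P, h ^ 3 = 1)
    (hG : ∀ g : G, ∃ a b, g = a ^ 3 * b ^ 3)
    {N : Subgroup (Equiv.Perm (G ⧸ P))} (hreg : IsRegularSubgroup N)
    (hnorm : (cosetPermHom P).range ≤ Subgroup.normalizer (N : Set _))
    (hle : N ≤ (cosetPermHom P).range) : P.Normal := by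
  have hM : (N.comap (cosetPermHom P)).Normal := ⟨fun m hm g => by
    have h := (Subgroup.mem_normalizer_iff.1 (hnorm ⟨g, rfl⟩) _).1 hm
    rw [Subgroup.mem_comap]
    simpa using h⟩
  have hcube : ∀ g : G, g ^ 3 ∈ N.comap (cosetPermHom P) := by
    intro g
    obtain ⟨σ, ⟨hσ, hσg⟩, -⟩ := hreg ((1 : G) : G ⧸ P) (g : G ⧸ P)
    obtain ⟨m, rfl⟩ := hle hσ
    rw [cosetPermHom_apply_mk, mul_one, QuotientGroup.eq] at hσg
    have hq : ((m⁻¹ * g : G) : G ⧸ N.comap (cosetPermHom P)) =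
        (g : G ⧸ N.comap (cosetPermHom P)) := by
      rw [QuotientGroup.mk_mul, (QuotientGroup.eq_one_iff (N := N.comap (cosetPermHom P)) m⁻¹).2
        (Subgroup.inv_mem (N.comap (cosetPermHom P)) hσ), one_mul]
    rw [← QuotientGroup.eq_one_iff, QuotientGroup.mk_pow, ← hq, ← QuotientGroup.mk_pow,
      hP _ hσg, QuotientGroup.mk_one]
  have hall : ∀ g : G, cosetPermHom P g ∈ N := by
    intro g
    obtain ⟨a, b, rfl⟩ := hG g
    exact Subgroup.mul_mem _ (hcube a) (hcube b)
  have hker : P = (cosetPermHom P).ker := by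
    ext h
    have h1 : cosetPermHom P h ((1 : G) : G ⧸ P) = ((1 : G) : G ⧸ P) ↔ h ∈ P := by
      rw [cosetPermHom_apply_mk, mul_one, eq_comm, QuotientGroup.eq, inv_one, one_mul]
    refine ⟨fun hh => ?_, fun hh => h1.1 (by rw [MonoidHom.mem_ker.1 hh]; rfl)⟩
    exact (hreg _ _).unique ⟨hall h, h1.2 hh⟩ ⟨N.one_mem, rfl⟩
  rw [hker]
  infer_instance

theorem exists_generator_of_card_eq_prime {p : ℕ} [Fact p.Prime] (h : Nat.card P = p) :
    ∃ z ∈ P, z ≠ 1 ∧ z ^ p = 1 ∧ ∀ g ∈ P, ∃ i < p, g = z ^ i := by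
  classical
  have hc : IsCyclic P := isCyclic_of_prime_card h
  obtain ⟨⟨z, hz⟩, hgen⟩ := hc.exists_generator
  have hp : orderOf z = p := by
    rw [← h, ← orderOf_eq_card_of_forall_mem_zpowers hgen, Subgroup.orderOf_mk]
  refine ⟨z, hz, ?_, hp ▸ pow_orderOf_eq_one z, fun g hg => ?_⟩
  · rintro rfl
    exact (Fact.out : p.Prime).one_lt.ne (by simpa using hp)
  · have hfin : IsOfFinOrder z := by
      rw [← orderOf_pos_iff, hp]
      exact (Fact.out : p.Prime).pos
    obtain ⟨i, hi⟩ := hgen ⟨g, hg⟩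
    have hmem : g ∈ Subgroup.zpowers z := ⟨i, congr_arg Subtype.val hi⟩
    rw [← hfin.mem_powers_iff_mem_zpowers, hfin.mem_powers_iff_mem_range_orderOf] at hmem
    obtain ⟨j, hj, hjg⟩ := Finset.mem_image.1 hmem
    exact ⟨j, hp ▸ Finset.mem_range.1 hj, hjg.symm⟩

/-- Conjugation by `σ` carries left translation by `n` to left translation by `a n`. -/
theorem mem_holomorph_of_map_mul {N : Type*} [Group N] {σ : Equiv.Perm N} {a : MulAut N}
    (h : ∀ n m, σ (n * m) = a n * σ m) : σ ∈ holomorph N := by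
  refine Subgroup.mem_normalizer_iff.2 fun τ => ⟨?_, ?_⟩
  · rintro ⟨n, rfl⟩
    refine ⟨a n, Equiv.ext fun m => ?_⟩
    change a n * m = σ (n * σ⁻¹ m)
    rw [h]
    exact congr_arg _ (σ.apply_symm_apply m).symm
  · rintro ⟨n, hn⟩
    refine ⟨a.symm n, Equiv.ext fun m => σ.injective ?_⟩
    change σ (a.symm n * m) = σ (τ m)
    rw [h, MulEquiv.apply_symm_apply]
    have := Equiv.congr_fun hn (σ m)
    change n * σ m = σ (τ (σ⁻¹ (σ m))) at this
    rw [this]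
    exact congr_arg (fun x => σ (τ x)) (σ.symm_apply_apply m)

end RegularSubgroups

/-! ### Computations in `S₃ × S₃` and `S₃ × C₂`. -/

section SymmetricThree

open Equiv

/-- Transpositions are their own cubes, and a 3-cycle is a product of two of them. -/
theorem perm_three_mul_cubes (a : Perm (Fin 3)) : ∃ b c : Perm (Fin 3), a = b ^ 3 * c ^ 3 := by
  revert a; decide +kernel

theorem perm_three_conj_of_cube (x y : Perm (Fin 3)) :
    x ^ 3 = 1 → y ^ 3 = 1 → x ≠ 1 → y ≠ 1 → ∃ t, t * x * t⁻¹ = y := by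
  revert x y; decide +kernel

theorem perm_three_conj_mem (y b : Perm (Fin 3)) :
    y ^ 3 = 1 → b * y * b⁻¹ = y ∨ b * y * b⁻¹ = y ^ 2 := by
  revert y b; decide +kernel

theorem perm_three_even_iff (y a : Perm (Fin 3)) :
    y ^ 3 = 1 → y ≠ 1 → (Perm.sign a = 1 ↔ a = y ^ 0 ∨ a = y ^ 1 ∨ a = y ^ 2) := by
  revert y a; decide +kernel

theorem perm_three_sign_of_sq (x : Perm (Fin 3)) : x ^ 2 = 1 → x ≠ 1 → Perm.sign x = -1 := by
  revert x; decide

theorem perm_three_center (a : Perm (Fin 3)) : (∀ s : Perm (Fin 3), a * s * a⁻¹ = s) → a = 1 := by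
  revert a; decide

/-- The group `S₃ × C₂`. -/
abbrev PermSign := Perm (Fin 3) × ℤˣ

/-- The isomorphism of the dihedral group of order `12` with `S₃ × C₂`, as a map. -/
def dihedralToPermSign : DihedralGroup 6 → PermSign
  | .r i => (finRotate 3, -1) ^ i.val
  | .sr i => (swap 0 1, 1) * (finRotate 3, -1) ^ i.val

theorem dihedralToPermSign_bijective : Function.Bijective dihedralToPermSign := by
  decide +kernel

theorem dihedralToPermSign_mul :
    ∀ x y, dihedralToPermSign (x * y) = dihedralToPermSign x * dihedralToPermSign y := by
  decide +kernel

/-- The dihedral group of order `12` is isomorphic to `S₃ × C₂`. -/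
noncomputable def dihedralEquivPermSign : DihedralGroup 6 ≃* PermSign :=
  { Equiv.ofBijective dihedralToPermSign dihedralToPermSign_bijective with
    map_mul' := dihedralToPermSign_mul }

/-- The action of `S₃ × S₃` on `S₃ × C₂` by conjugation of `S₃` through the first factor. -/
def permSignAut : Perm (Fin 3) × Perm (Fin 3) →* MulAut PermSign :=
  MulAut.conj.comp ((MonoidHom.inl _ _).comp (MonoidHom.fst _ _))

/-- The action `(a, b) • (s, ε) = (a s b⁻¹, sign(a) ε)` of `S₃ × S₃` on `S₃ × C₂`. -/
def permSignPerm : Perm (Fin 3) × Perm (Fin 3) →* Perm PermSign where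
  toFun p := (Equiv.mulLeft (p.1, Perm.sign p.1)).trans (Equiv.mulRight (p.2⁻¹, 1))
  map_one' := by
    refine Equiv.ext fun x => ?_
    simp [Prod.ext_iff]
  map_mul' p q := by
    refine Equiv.ext fun x => ?_
    simp [mul_assoc, Prod.ext_iff]

theorem permSignPerm_apply (p : Perm (Fin 3) × Perm (Fin 3)) (x : PermSign) :
    permSignPerm p x = (p.1 * x.1 * p.2⁻¹, Perm.sign p.1 * x.2) := by
  simp [permSignPerm, Prod.ext_iff]

theorem permSignPerm_mul (p : Perm (Fin 3) × Perm (Fin 3)) (x y : PermSign) :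
    permSignPerm p (x * y) = permSignAut p x * permSignPerm p y := by
  rw [permSignPerm_apply, permSignPerm_apply]
  ext1
  · simp [permSignAut, mul_assoc]
  · simp [permSignAut, mul_left_comm]

theorem permSignPerm_transitive (x : PermSign) : ∃ p, permSignPerm p 1 = x := by
  obtain ⟨a, ha⟩ := Perm.sign_surjective (Fin 3) x.2
  refine ⟨(a, x.1⁻¹ * a), ?_⟩
  rw [permSignPerm_apply]
  ext1 <;> simp [ha]

theorem permSignPerm_one_eq_one_iff (p : Perm (Fin 3) × Perm (Fin 3)) :
    permSignPerm p 1 = 1 ↔ p.1 = p.2 ∧ Perm.sign p.1 = 1 := by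
  rw [permSignPerm_apply]
  simp [Prod.ext_iff, mul_inv_eq_one]

theorem permSignPerm_injective : Function.Injective permSignPerm := by
  rw [injective_iff_map_eq_one]
  rintro ⟨a, b⟩ h
  have h1 := ((permSignPerm_one_eq_one_iff (a, b)).1 (by rw [h]; rfl)).1
  -- Fixing 1 gives `a = b`; fixing every `(s, 1)` then makes `a` central in `S₃`.
  have h2 : a = 1 := perm_three_center a fun s => by
    have h3 := congr_arg Prod.fst (Equiv.congr_fun h (s, 1))
    rw [permSignPerm_apply] at h3
    rw [show a = b from h1]
    rw [show a = b from h1] at h3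
    exact h3
  rw [← show a = b from h1, h2]
  rfl

theorem exists_equiv_diagonal {G : Type*} [Group G] (e : G ≃* Perm (Fin 3) × Perm (Fin 3))
    {P : Subgroup G} (hP : Nat.card P = 3) (hn : ¬ P.Normal) :
    ∃ e' : G ≃* Perm (Fin 3) × Perm (Fin 3),
      ∀ g, g ∈ P ↔ (e' g).1 = (e' g).2 ∧ Perm.sign (e' g).1 = 1 := by
  have : Fact (Nat.Prime 3) := ⟨Nat.prime_three⟩
  obtain ⟨z, hz, -, hz3, hgen⟩ := exists_generator_of_card_eq_prime hP
  -- If a component of `z` were trivial, every conjugate of `z` would be `z` or `z ^ 2`, making `P`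
  -- normal.
  have hnc : ¬ ∀ g, g * z * g⁻¹ = z ∨ g * z * g⁻¹ = z ^ 2 := by
    intro h
    refine hn ⟨fun n hn g => ?_⟩
    obtain ⟨i, -, rfl⟩ := hgen n hn
    rw [← conj_pow]
    refine P.pow_mem ?_ i
    rcases h g with h | h <;> rw [h]
    exacts [hz, P.pow_mem hz 2]
  have h3 : (e z).1 ^ 3 = 1 ∧ (e z).2 ^ 3 = 1 := by
    have := congr_arg e hz3
    rw [map_pow, map_one] at this
    exact ⟨congr_arg Prod.fst this, congr_arg Prod.snd this⟩
  have hx : (e z).1 ≠ 1 := by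
    intro hx
    refine hnc fun g => ?_
    rcases perm_three_conj_mem _ (e g).2 h3.2 with h | h
    · left
      apply e.injective
      ext1 <;> simp [hx, h]
    · right
      apply e.injective
      ext1 <;> simp [hx, h]
  have hy : (e z).2 ≠ 1 := by
    intro hy
    refine hnc fun g => ?_
    rcases perm_three_conj_mem _ (e g).1 h3.1 with h | h
    · left
      apply e.injective
      ext1 <;> simp [hy, h]
    · right
      apply e.injective
      ext1 <;> simp [hy, h]
  obtain ⟨t, ht⟩ := perm_three_conj_of_cube _ _ h3.1 h3.2 hx hy
  -- Conjugating the first factor by `t` makes the two components of `z` equal.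
  let e' : G ≃* Perm (Fin 3) × Perm (Fin 3) :=
    e.trans (MulEquiv.prodCongr (MulAut.conj t) (MulEquiv.refl _))
  have hez : e' z = ((e z).2, (e z).2) := Prod.ext ht rfl
  have hpow : ∀ i, e' (z ^ i) = ((e z).2 ^ i, (e z).2 ^ i) := fun i => by
    rw [map_pow, hez]; rfl
  refine ⟨e', fun g => ⟨fun hg => ?_, fun ⟨h1, h2⟩ => ?_⟩⟩
  · obtain ⟨i, -, rfl⟩ := hgen g hg
    rw [hpow]
    refine ⟨rfl, ?_⟩
    rw [map_pow, (perm_three_even_iff _ _ h3.2 hy).2 (Or.inr (Or.inl (pow_one _).symm)), one_pow]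
  · have h4 : ∃ i, (e' g).1 = (e z).2 ^ i := by
      rcases (perm_three_even_iff _ _ h3.2 hy).1 h2 with h | h | h
      exacts [⟨0, h⟩, ⟨1, h⟩, ⟨2, h⟩]
    obtain ⟨i, hi⟩ := h4
    have : g = z ^ i := e'.injective (by rw [hpow]; exact Prod.ext hi (h1 ▸ hi))
    rw [this]
    exact P.pow_mem hz i

theorem exists_sign_of_card_two {G : Type*} [Group G] (e : G ≃* Perm (Fin 3) × Perm (Fin 3))
    {P : Subgroup G} (hP : Nat.card P = 2) :
    ∃ χ : G →* ℤˣ, (∀ h ∈ P, χ h = 1 → h = 1) ∧ ∃ h ∈ P, χ h = -1 := by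
  have : Fact (Nat.Prime 2) := ⟨Nat.prime_two⟩
  obtain ⟨z, hz, hz1, hz2, hgen⟩ := exists_generator_of_card_eq_prime hP
  suffices h : ∃ χ : G →* ℤˣ, χ z = -1 by
    obtain ⟨χ, hχ⟩ := h
    refine ⟨χ, fun h hh h1 => ?_, z, hz, hχ⟩
    obtain ⟨i, hi, rfl⟩ := hgen h hh
    interval_cases i
    · exact pow_zero z
    · rw [pow_one, hχ] at h1
      exact absurd h1 (by decide)
  have h2 : (e z).1 ^ 2 = 1 ∧ (e z).2 ^ 2 = 1 := by
    have := congr_arg e hz2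
    rw [map_pow, map_one] at this
    exact ⟨congr_arg Prod.fst this, congr_arg Prod.snd this⟩
  by_cases hx : (e z).1 = 1
  · have hy : (e z).2 ≠ 1 := fun hy => hz1 (e.injective (by rw [map_one]; exact Prod.ext hx hy))
    exact ⟨(Perm.sign.comp (MonoidHom.snd _ _)).comp e.toMonoidHom,
      by simpa using perm_three_sign_of_sq _ h2.2 hy⟩
  · exact ⟨(Perm.sign.comp (MonoidHom.fst _ _)).comp e.toMonoidHom,
      by simpa using perm_three_sign_of_sq _ h2.1 hx⟩

end SymmetricThree

/-! ### Finiteness, separability and minimality of the normal closure. -/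

section NormalClosure

variable {k L : Type*} [Field k] [Field L] [Algebra k L]

theorem finiteDimensional_of_isNormalClosure {K : IntermediateField k L} [FiniteDimensional k K]
    (hL : IsNormalClosure k K L) : FiniteDimensional k L := by
  have h := (Algebra.IsAlgebraic.isNormalClosure_iff.1 hL).2
  have h2 : FiniteDimensional k (IntermediateField.normalClosure k K L) := inferInstance
  rw [h] at h2
  exact Module.Finite.equiv (IntermediateField.topEquiv (F := k) (E := L)).toLinearEquiv

theorem isGalois_of_isNormalClosure {K : IntermediateField k L} [Algebra.IsSeparable k K]
    (hL : IsNormalClosure k K L) : IsGalois k L := by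
  have hn : Normal k L := hL.normal
  have hs : Algebra.IsSeparable k L := by
    rw [← separableClosure.eq_top_iff, eq_top_iff, ← hL.adjoin_rootSet]
    refine iSup_le fun x => IntermediateField.adjoin_le_iff.2 fun y hy => ?_
    exact mem_separableClosure_iff.2 ((Algebra.IsSeparable.isSeparable k x).of_dvd
      (minpoly.dvd k y (Polynomial.mem_rootSet.1 hy).2))
  exact ⟨⟩

theorem not_normal_fixingSubgroup [FiniteDimensional k L] [IsGalois k L] {F : IntermediateField k L}
    (hF : IsNormalClosure k F L) (hne : F ≠ ⊤) : ¬ F.fixingSubgroup.Normal := by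
  intro h
  have := ((InfiniteGalois.normal_iff_isGalois F).1 h).to_normal
  exact hne ((IntermediateField.normalClosure_of_normal F).symm.trans
    (Algebra.IsAlgebraic.isNormalClosure_iff.1 hF).2)

end NormalClosure

theorem mainTheorem7 {k L : Type*} [Field k] [Field L] [Algebra k L]
    (K F : IntermediateField k L)
    (hsep : Algebra.IsSeparable k K)
    (hdeg : Module.finrank k K = 6)
    (hL : IsNormalClosure k K L)
    (hG : Nonempty ((L ≃ₐ[k] L) ≃* Equiv.Perm (Fin 3) × Equiv.Perm (Fin 3)))
    (hKF : K ≤ F) :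
    (Module.finrank k F = 18 →
      IsAlmostClassicallyGalois F (isNormalClosure_of_le hL hKF)) ∧
    (Module.finrank k F = 12 →
      IsHopfGalois k F ∧
      (∃ β : (L ≃ₐ[k] L) →* Equiv.Perm (DihedralGroup 6),
        Function.Injective β ∧
        β.range ≤ holomorph (DihedralGroup 6) ∧
        ∀ g : L ≃ₐ[k] L, β g 1 = 1 ↔ g ∈ F.fixingSubgroup) ∧
      ¬ IsAlmostClassicallyGalois F (isNormalClosure_of_le hL hKF)) := by
  have : FiniteDimensional k K := Module.finite_of_finrank_pos (by rw [hdeg]; norm_num)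
  have : FiniteDimensional k L := finiteDimensional_of_isNormalClosure hL
  have : IsGalois k L := isGalois_of_isNormalClosure hL
  obtain ⟨e⟩ := hG
  have hcard : Module.finrank k L = 36 := by
    rw [← IsGalois.card_aut_eq_finrank, Nat.card_congr e.toEquiv, Nat.card_prod,
      Nat.card_eq_fintype_card, Fintype.card_perm]
    rfl
  have hP : Module.finrank k F * Nat.card F.fixingSubgroup = 36 := by
    rw [IsGalois.card_fixingSubgroup_eq_finrank, Module.finrank_mul_finrank, hcard]
  refine ⟨fun h18 => ?_, fun h12 => ?_⟩
  · obtain ⟨χ, h1, h2⟩ := exists_sign_of_card_two e (P := F.fixingSubgroup)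
      (by rw [h18] at hP; omega)
    exact exists_regular_of_sign χ h1 h2
  · have hP3 : Nat.card F.fixingSubgroup = 3 := by rw [h12] at hP; omega
    have hne : F ≠ ⊤ := by
      rintro rfl
      rw [IntermediateField.finrank_top', hcard] at h12
      omega
    have hnn := not_normal_fixingSubgroup (isNormalClosure_of_le hL hKF) hne
    obtain ⟨e', he'⟩ := exists_equiv_diagonal e hP3 hnn
    refine ⟨?_, ?_, ?_⟩
    · refine isHopfGalois_of_holomorphAction (N := PermSign)
        { α := permSignAut.comp e'.toMonoidHom
          β := permSignPerm.comp e'.toMonoidHom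
          β_mul := fun g => permSignPerm_mul (e' g)
          exists_eq := fun n => ?_
          stabilizer := fun g => (permSignPerm_one_eq_one_iff (e' g)).trans (he' g).symm } ?_
      · obtain ⟨p, hp⟩ := permSignPerm_transitive n
        exact ⟨e'.symm p, by simpa using hp⟩
      · rw [h12, Nat.card_prod, Nat.card_eq_fintype_card, Fintype.card_perm,
          Nat.card_eq_fintype_card]
        rfl
    -- The action on `S₃ × C₂` is transported along `φ`, which carries automorphism parts to
    -- automorphism parts and 1 to 1.
    · let φ := dihedralEquivPermSign
      refine ⟨(φ.symm.toEquiv.permCongrHom.toMonoidHom.comp permSignPerm).comp e'.toMonoidHom,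
        ?_, ?_, fun g => ?_⟩
      · exact (φ.symm.toEquiv.permCongrHom.injective.comp permSignPerm_injective).comp e'.injective
      · rintro _ ⟨g, rfl⟩
        refine mem_holomorph_of_map_mul (a := (φ.trans (permSignAut (e' g))).trans φ.symm) ?_
        intro n m
        change φ.symm (permSignPerm (e' g) (φ (n * m))) =
          φ.symm (permSignAut (e' g) (φ n)) * φ.symm (permSignPerm (e' g) (φ m))
        rw [map_mul φ, permSignPerm_mul, map_mul]
      · change φ.symm (permSignPerm (e' g) (φ 1)) = 1 ↔ _
        rw [map_one, he', ← permSignPerm_one_eq_one_iff]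
        exact ⟨fun h => φ.symm.injective (h.trans (map_one _).symm), fun h => by rw [h, map_one]⟩
    · rintro ⟨N, hreg, hnorm, hle⟩
      refine hnn (normal_of_regular_of_cubes (fun h hh => ?_) (fun g => ?_) hreg hnorm hle)
      · have := pow_card_eq_one' (x := (⟨h, hh⟩ : F.fixingSubgroup))
        rw [hP3] at this
        exact congr_arg Subtype.val this
      · obtain ⟨b, c, h1⟩ := perm_three_mul_cubes (e g).1
        obtain ⟨b', c', h2⟩ := perm_three_mul_cubes (e g).2
        refine ⟨e.symm (b, b'), e.symm (c, c'), e.injective ?_⟩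
        simp only [map_mul, map_pow, MulEquiv.apply_symm_apply]
        exact Prod.ext h1 h2
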